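/- Let $n\ge 2$ and let $d(x)=\mathrm{dist}(x,\partial B_R)$ on the ball $B_R=\{|x|<R\}\subset\mathbb R^n$. For $n<q\le\infty$ put $\beta_q=\frac{1}{1-n/q}$, $\gamma_q=\frac{1}{2-n/q}$ (so $\beta_\infty=1$, $\gamma_\infty=\frac12$), and $$\|h\|_{q,r,\Omega}=\sup_{x\in\Omega}\|h\|_{L^q(\Omega\cap B_r(x))},\qquad [\psi]_{\alpha,r,\Omega}=\sup_{x\in\overline\Omega}\ \sup_{y,z\in B_r(x)\cap\Omega}\frac{|\psi(y)-\psi(z)|}{|y-z|^{\alpha}} .$$ For an operator $\mathcal L u=\mathrm{div}(A\nabla u+b_1u)+b_2\cdot\nabla u+cu$ on $\Omega=B_R$ and $0<\alpha<1-n/q$ let $$r_0(\mathcal L,\Omega)=\sup\Bigl\{r>0:\ r\Bigl(r_\Omega^{-1}+[A]_{\alpha,r,\Omega}^{1/\alpha}+\|b_1\|_{L^\infty(\Omega)}+[b_1]_{\alpha,r,\Omega}^{1/(1+\alpha)}+\|b_2\|_{q,r,\Omega}^{\beta_q}+\|c\|_{q,r,\Omega}^{\gamma_q}\Bigr)\le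 1\Bigr\},$$ where $r_{B_R}=c_\Omega R$ with a constant $c_\Omega>0$ (the regularity radius of the ball; any value of $c_\Omega$ is allowed). There exist constants $\lambda_0=\lambda_0(n)>0$ and $C=C(n)>0$, depending only on $n$, such that for all such $q,\alpha,c_\Omega$ and all $R>0$ the following two assertions hold. (a) There are a sequence $c_i\in C^\infty(\overline{B_R})$ and classical solutions $u_i\in C^2(B_R)\cap C(\overline{B_R})$, $u_i>0$ in $B_R$, of $$-\mathcal L_iu_i:=-\Delta u_i+c_iu_i=0\ \text{ in }B_R,\qquad u_i=0\ \text{ on }\partial B_R,$$ such that, with $r_i=r_0(\mathcal L_i,B_R)$ and $M_i=\|c_i\|_{q,r_i,B_R}^{\gamma_q}$, one has $\|c_i\|_{q,r_i,B_R}\to\infty$ (hence $M_i\to\infty$) and, for all $i$, $$\frac{\sup_{B_R}(u_i/d)}{\inf_{B_R}(u_i/d)}\ge C e^{CM_iR},\qquad \frac{|\nabla u_i|}{u_i}\ge CM_i\ \text{ on }\{|x|=R/2\},\tag{$*$}$$ where $\sup_{B_R}(u_i/d)<\infty$ and $\inf_{B_R}(u_i/d)>0$. (b) There are a sequence $b_i\in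 C^\infty(\overline{B_R};\mathbb R^n)$ and classical solutions $u_i\in C^2(B_R)\cap C(\overline{B_R})$, $u_i>0$ in $B_R$, of $$-\mathcal L_iu_i:=-\Delta u_i+b_i\cdot\nabla u_i-\lambda_0R^{-2}u_i=0\ \text{ in }B_R,\qquad u_i=0\ \text{ on }\partial B_R,$$ such that, with $r_i=r_0(\mathcal L_i,B_R)$ and $M_i=\|b_i\|_{q,r_i,B_R}^{\beta_q}$, one has $\|b_i\|_{q,r_i,B_R}\to\infty$ (hence $M_i\to\infty$) and $(*)$ holds for all $i$, again with $\sup_{B_R}(u_i/d)<\infty$ and $\inf_{B_R}(u_i/d)>0$. -/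

import Mathlib

open Set Filter Topology MeasureTheory Metric
open scoped ENNReal NNReal ContDiff

noncomputable section

/-- The coefficients of the second order operator in divergence form
`L u = div (A ∇u + b₁ u) + b₂ · ∇u + c u` in dimension `n`. -/
structure DivFormOperator (n : ℕ) where
  A : EuclideanSpace ℝ (Fin n) → (EuclideanSpace ℝ (Fin n) →L[ℝ] EuclideanSpace ℝ (Fin n))
  b₁ : EuclideanSpace ℝ (Fin n) → EuclideanSpace ℝ (Fin n)
  b₂ : EuclideanSpace ℝ (Fin n) → EuclideanSpace ℝ (Fin n)
  c : EuclideanSpace ℝ (Fin n) → ℝ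

/-- The uniformly local Lebesgue norm `‖h‖_{q,r,Ω} = sup_{x ∈ Ω} ‖h‖_{L^q(Ω ∩ B_r(x))}`. -/
def ulNorm {n : ℕ} {F : Type*} [NormedAddCommGroup F] (q : ℝ≥0∞) (r : ℝ)
    (Ω : Set (EuclideanSpace ℝ (Fin n))) (h : EuclideanSpace ℝ (Fin n) → F) : ℝ≥0∞ :=
  ⨆ x ∈ Ω, eLpNorm h q (volume.restrict (Ω ∩ ball x r))

/-- The uniformly local Hölder bracket
`[ψ]_{α,r,Ω} = sup_{x ∈ closure Ω} sup_{y, z ∈ B_r(x) ∩ Ω} |ψ y - ψ z| / |y - z|^α`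
(the quotient is `0` for `y = z`). -/
def ulHolder {n : ℕ} {F : Type*} [NormedAddCommGroup F] (α r : ℝ)
    (Ω : Set (EuclideanSpace ℝ (Fin n))) (ψ : EuclideanSpace ℝ (Fin n) → F) : ℝ≥0∞ :=
  ⨆ x ∈ closure Ω, ⨆ y ∈ ball x r ∩ Ω, ⨆ z ∈ ball x r ∩ Ω,
    edist (ψ y) (ψ z) / edist y z ^ α

/-- The exponent `β_q = 1 / (1 - n / q)`; it is `1` for `q = ∞`. -/
def betaExp (n : ℕ) (q : ℝ≥0∞) : ℝ := 1 / (1 - ((n : ℝ≥0∞) / q).toReal)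

/-- The exponent `γ_q = 1 / (2 - n / q)`; it is `1 / 2` for `q = ∞`. -/
def gammaExp (n : ℕ) (q : ℝ≥0∞) : ℝ := 1 / (2 - ((n : ℝ≥0∞) / q).toReal)

/-- The sum of the scaled sizes, at the scale `r`, of the coefficients of `L` in `Ω`. -/
def DivFormOperator.coeffSize {n : ℕ} (L : DivFormOperator n) (q : ℝ≥0∞) (α r : ℝ)
    (Ω : Set (EuclideanSpace ℝ (Fin n))) : ℝ≥0∞ :=
  ulHolder α r Ω L.A ^ (1 / α) + eLpNorm L.b₁ ∞ (volume.restrict Ω)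
    + ulHolder α r Ω L.b₁ ^ (1 / (1 + α)) + ulNorm q r Ω L.b₂ ^ betaExp n q
    + ulNorm q r Ω L.c ^ gammaExp n q

/-- The intrinsic radius `r₀(L, Ω)`: the supremum of all `r > 0` with
`r * (1 / rΩ + coeffSize r) ≤ 1`, where `rΩ > 0` is the regularity radius of the domain `Ω`. -/
def DivFormOperator.r₀ {n : ℕ} (L : DivFormOperator n) (q : ℝ≥0∞) (α rΩ : ℝ)
    (Ω : Set (EuclideanSpace ℝ (Fin n))) : ℝ :=
  sSup {r : ℝ | 0 < r ∧
    ENNReal.ofReal r * (ENNReal.ofReal rΩ⁻¹ + L.coeffSize q α r Ω) ≤ 1}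

/-- The operator `L` with `-L u = -Δ u + c u`. -/
def schrodingerOp {n : ℕ} (c : EuclideanSpace ℝ (Fin n) → ℝ) : DivFormOperator n where
  A := fun _ => ContinuousLinearMap.id ℝ (EuclideanSpace ℝ (Fin n))
  b₁ := fun _ => 0
  b₂ := fun _ => 0
  c := fun x => -c x

/-- The operator `L` with `-L u = -Δ u + b · ∇u - μ u`, where `μ` is a constant. -/
def driftOp {n : ℕ} (b : EuclideanSpace ℝ (Fin n) → EuclideanSpace ℝ (Fin n)) (μ : ℝ) :
    DivFormOperator n where
  A := fun _ => ContinuousLinearMap.id ℝ (EuclideanSpace ℝ (Fin n))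
  b₁ := fun _ => 0
  b₂ := fun x => -b x
  c := fun _ => μ

/-- `u` is a positive classical solution (in `C²(B_R) ∩ C(closure B_R)`) of the Dirichlet problem
`-Δ u + b · ∇u + c u = 0` in `B_R`, `u = 0` on the boundary of `B_R`. -/
structure IsPositiveDirichletSolution {n : ℕ} (R : ℝ)
    (b : EuclideanSpace ℝ (Fin n) → EuclideanSpace ℝ (Fin n))
    (c u : EuclideanSpace ℝ (Fin n) → ℝ) : Prop where
  contDiffOn : ContDiffOn ℝ 2 u (ball 0 R)
  continuousOn : ContinuousOn u (closedBall 0 R)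
  pos : ∀ x ∈ ball (0 : EuclideanSpace ℝ (Fin n)) R, 0 < u x
  boundary : ∀ x ∈ frontier (ball (0 : EuclideanSpace ℝ (Fin n)) R), u x = 0
  equation : ∀ x ∈ ball (0 : EuclideanSpace ℝ (Fin n)) R,
    -(Laplacian.laplacian u x) + inner ℝ (b x) (gradient u x) + c x * u x = 0

/-- The set of the values of `u / d` in `B_R`, where `d` is the distance to the boundary. -/
def distQuotients {n : ℕ} (R : ℝ) (u : EuclideanSpace ℝ (Fin n) → ℝ) : Set ℝ :=
  (fun x => u x / infDist x (frontier (ball (0 : EuclideanSpace ℝ (Fin n)) R))) ''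
    ball (0 : EuclideanSpace ℝ (Fin n)) R

/-- The lower bounds `sup (u/d) / inf (u/d) ≥ C exp (C M R)` (with finite supremum and positive
infimum over `B_R`) and `|∇u| / u ≥ C M` on the sphere `|x| = R / 2`. -/
structure HarnackLowerBounds {n : ℕ} (R C M : ℝ) (u : EuclideanSpace ℝ (Fin n) → ℝ) : Prop where
  bddAbove : BddAbove (distQuotients R u)
  inf_pos : 0 < sInf (distQuotients R u)
  harnack : C * Real.exp (C * M * R) ≤ sSup (distQuotients R u) / sInf (distQuotients R u)
  logGrad : ∀ x : EuclideanSpace ℝ (Fin n), ‖x‖ = R / 2 → C * M ≤ ‖gradient u x‖ / u x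

end

/-!
Both assertions have explicit radial solutions. With `t = |x|² / R²` and a quadratic
`g t = a t + m t² / 2` with nonnegative derivative on `[0, 1]`, take `u = (1 - t) exp (-g t)`
(`dampedBump`). Since `(1 - t) / (R - |x|) = (R + |x|) / R²`, the quotient `u / d` is comparable to
`exp (-g t) / R`, and a parameter `k` of order `g'` gives a drop of `u / d` by `exp (-k / 32)` and
a logarithmic gradient at least of order `k / R` on `|x| = R / 2` (`harnackLowerBounds_dampedBump`).

* For the Schrödinger operator the potential is `c = Δu / u`. It is regular at the boundary if
  `1 - t` divides the derivative term, that is, if `g' 1 = n / 4`. With `g' t = n / 4 + k (1 - t)`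
  the potential is a polynomial in `t`, of size `(k / R)²`.
* For the drift operator `b` is the radial field `(Δu + λ₀ R⁻² u) ∇u / |∇u|²`. It is regular at the
  origin if `λ₀ = 2 n (1 + g' 0)`. With `g' t = 1 + k t`, hence `λ₀ = 4 n`, it is `x / R²` times a
  rational function of `t` whose denominator is at least `1`, and its size is `k / R`.

It remains to compare `k / R` with `M = N ^ (1 / (θ - n / q))`, where `N` is the uniformly local
norm at the scale `r₀`, and `θ = 2` for potentials, `θ = 1` for drifts. By the definition of `r₀`,
`r₀ M ≤ 1`, while `N ≲ (k / R)^θ r₀^{n / q}` by the pointwise bound. Hence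
`M^θ = M^{n / q} N ≲ (k / R)^θ (r₀ M)^{n / q} ≤ (k / R)^θ`, with a constant depending only on `n`
(`DivFormOperator.ulNorm_r₀_rpow_le`). Conversely `r₀ ≳ R / k` for large `k`, and the coefficients
are bounded below on a fixed ball, so `N → ∞` (`DivFormOperator.tendsto_ulNorm_r₀`).
-/

noncomputable section

/-! ### Uniformly local norms -/

variable {n : ℕ}

section Norms

variable {F : Type*} [NormedAddCommGroup F]

/-- The volume of the unit ball of `ℝⁿ`. -/
def unitBallVol (n : ℕ) : ℝ := volume.real (ball (0 : EuclideanSpace ℝ (Fin n)) 1)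

lemma unitBallVol_pos : 0 < unitBallVol n :=
  ENNReal.toReal_pos (measure_ball_pos _ _ one_pos).ne' measure_ball_lt_top.ne

lemma volume_ball_eq (x : EuclideanSpace ℝ (Fin n)) {r : ℝ} (hr : 0 < r) :
    volume (ball x r) = ENNReal.ofReal (r ^ n * unitBallVol n) := by
  rw [Measure.addHaar_ball_of_pos _ _ hr, finrank_euclideanSpace, Fintype.card_fin,
    ENNReal.ofReal_mul (by positivity), unitBallVol, Measure.real,
    ENNReal.ofReal_toReal measure_ball_lt_top.ne]

lemma ulNorm_mono (q : ℝ≥0∞) {r s : ℝ} (hrs : r ≤ s) (Ω : Set (EuclideanSpace ℝ (Fin n)))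
    (h : EuclideanSpace ℝ (Fin n) → F) : ulNorm q r Ω h ≤ ulNorm q s Ω h :=
  iSup₂_mono fun _ _ => eLpNorm_mono_measure _ <|
    Measure.restrict_mono (inter_subset_inter_right _ (ball_subset_ball hrs)) le_rfl

/-- The uniformly local norm is left continuous in the radius: by Fatou's lemma, a bound for all
smaller radii passes to the limit. -/
lemma ulNorm_le_of_forall_lt {q : ℝ≥0∞} {s : ℝ} {Ω : Set (EuclideanSpace ℝ (Fin n))}
    (hΩ : MeasurableSet Ω) {h : EuclideanSpace ℝ (Fin n) → F}
    (hm : AEStronglyMeasurable h (volume.restrict Ω)) {B : ℝ≥0∞}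
    (hB : ∀ r < s, ulNorm q r Ω h ≤ B) : ulNorm q s Ω h ≤ B := by
  refine iSup₂_le fun x hx => ?_
  obtain ⟨v, -, hv, hvs⟩ := exists_seq_strictMono_tendsto s
  have hms : ∀ r, MeasurableSet (Ω ∩ ball x r) := fun r => hΩ.inter measurableSet_ball
  rw [← eLpNorm_indicator_eq_eLpNorm_restrict (hms s)]
  refine (Lp.eLpNorm_lim_le_liminf_eLpNorm (f := fun j => (Ω ∩ ball x (v j)).indicator h)
    (fun j => ?_) _ (ae_of_all _ fun y => ?_)).trans ?_
  · rw [aestronglyMeasurable_indicator_iff (hms _)]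
    exact hm.mono_measure (Measure.restrict_mono inter_subset_left le_rfl)
  · by_cases hy : y ∈ Ω ∩ ball x s
    · refine tendsto_const_nhds.congr' ?_
      filter_upwards [hvs.eventually (lt_mem_nhds (mem_ball.1 hy.2))] with j hj
      have hyj : y ∈ Ω ∩ ball x (v j) := ⟨hy.1, mem_ball.2 hj⟩
      rw [indicator_of_mem hy, indicator_of_mem hyj]
    · refine tendsto_const_nhds.congr fun j => ?_
      have hj : y ∉ Ω ∩ ball x (v j) :=
        fun h' => hy ⟨h'.1, ball_subset_ball (hv j).le h'.2⟩
      rw [indicator_of_notMem hy, indicator_of_notMem hj]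
  · refine liminf_le_of_le (by isBoundedDefault) fun b hb => ?_
    obtain ⟨j, hj⟩ := hb.exists
    refine hj.trans ?_
    rw [eLpNorm_indicator_eq_eLpNorm_restrict (hms _)]
    exact (le_iSup₂ (f := fun x _ => eLpNorm h q (volume.restrict (Ω ∩ ball x (v j)))) x hx).trans
      (hB _ (hv j))

lemma natCast_div_toReal (n : ℕ) (q : ℝ≥0∞) : ((n : ℝ≥0∞) / q).toReal = n * q.toReal⁻¹ := by
  rw [ENNReal.toReal_div, ENNReal.toReal_natCast, div_eq_mul_inv]

lemma ballVol_rpow (q : ℝ≥0∞) {r : ℝ} (hr : 0 < r) :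
    (r ^ n * unitBallVol n) ^ q.toReal⁻¹ =
      r ^ ((n : ℝ≥0∞) / q).toReal * unitBallVol n ^ q.toReal⁻¹ := by
  rw [Real.mul_rpow (by positivity) unitBallVol_pos.le, ← Real.rpow_natCast, ← Real.rpow_mul hr.le,
    natCast_div_toReal]

lemma inv_toReal_mem_Icc (hn : 2 ≤ n) {q : ℝ≥0∞} (hq : (n : ℝ≥0∞) < q) :
    0 ≤ q.toReal⁻¹ ∧ q.toReal⁻¹ ≤ 1 := by
  refine ⟨by positivity, ?_⟩
  rcases eq_or_ne q ∞ with rfl | hq'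
  · simp
  · refine inv_le_one_of_one_le₀ ?_
    have := (ENNReal.toReal_lt_toReal (ENNReal.natCast_ne_top n) hq').2 hq
    rw [ENNReal.toReal_natCast] at this
    have : (2 : ℝ) ≤ n := by exact_mod_cast hn
    linarith

lemma ulNorm_le_of_norm_le (hn : 2 ≤ n) {q : ℝ≥0∞} (hq : (n : ℝ≥0∞) < q) {r : ℝ} (hr : 0 < r)
    {Ω : Set (EuclideanSpace ℝ (Fin n))} (hΩ : MeasurableSet Ω)
    {h : EuclideanSpace ℝ (Fin n) → F} {D : ℝ} (hD0 : 0 ≤ D) (hD : ∀ x ∈ Ω, ‖h x‖ ≤ D) :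
    ulNorm q r Ω h ≤
      ENNReal.ofReal (D * max 1 (unitBallVol n) * r ^ ((n : ℝ≥0∞) / q).toReal) := by
  refine iSup₂_le fun x _ => ?_
  obtain ⟨he0, he1⟩ := inv_toReal_mem_Icc hn hq
  refine (eLpNorm_le_of_ae_bound (C := D) ?_).trans ?_
  · rw [ae_restrict_iff' (hΩ.inter measurableSet_ball)]
    exact ae_of_all _ fun y hy => hD y hy.1
  · rw [Measure.restrict_apply_univ]
    have h1 : volume (Ω ∩ ball x r) ^ q.toReal⁻¹ ≤
        ENNReal.ofReal (r ^ ((n : ℝ≥0∞) / q).toReal * unitBallVol n ^ q.toReal⁻¹) := by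
      rw [← ballVol_rpow q hr, ← ENNReal.ofReal_rpow_of_nonneg
        (mul_nonneg (by positivity) unitBallVol_pos.le) he0, ← volume_ball_eq x hr]
      exact ENNReal.rpow_le_rpow (measure_mono inter_subset_right) he0
    have h2 : unitBallVol n ^ q.toReal⁻¹ ≤ max 1 (unitBallVol n) := by
      rcases le_total (unitBallVol n) 1 with h | h
      · exact (Real.rpow_le_one unitBallVol_pos.le h he0).trans (le_max_left _ _)
      · refine le_trans ?_ (le_max_right _ _)
        simpa using Real.rpow_le_rpow_of_exponent_le h he1
    refine (mul_le_mul_left h1 _).trans ?_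
    rw [← ENNReal.ofReal_mul (mul_nonneg (by positivity) (Real.rpow_nonneg unitBallVol_pos.le _))]
    refine ENNReal.ofReal_le_ofReal ?_
    have h3 : 0 ≤ r ^ ((n : ℝ≥0∞) / q).toReal := by positivity
    calc _ = (D * r ^ ((n : ℝ≥0∞) / q).toReal) * unitBallVol n ^ q.toReal⁻¹ := by ring
      _ ≤ (D * r ^ ((n : ℝ≥0∞) / q).toReal) * max 1 (unitBallVol n) :=
          mul_le_mul_of_nonneg_left h2 (by positivity)
      _ = _ := by ring

lemma le_ulNorm_of_le_norm {q : ℝ≥0∞} (hq : (n : ℝ≥0∞) < q) {r : ℝ} (hr : 0 < r)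
    {Ω : Set (EuclideanSpace ℝ (Fin n))} {y : EuclideanSpace ℝ (Fin n)} (hy : ball y r ⊆ Ω)
    {h : EuclideanSpace ℝ (Fin n) → F} {δ : ℝ} (hδ0 : 0 ≤ δ) (hδ : ∀ x ∈ ball y r, δ ≤ ‖h x‖) :
    ENNReal.ofReal (δ * (r ^ ((n : ℝ≥0∞) / q).toReal * unitBallVol n ^ q.toReal⁻¹)) ≤
      ulNorm q r Ω h := by
  refine le_trans ?_
    (le_iSup₂ (f := fun x _ => eLpNorm h q (volume.restrict (Ω ∩ ball x r))) y
      (hy (mem_ball_self hr)))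
  rw [inter_eq_right.2 hy]
  have hpos : 0 < r ^ n * unitBallVol n := mul_pos (by positivity) unitBallVol_pos
  have hne : volume.restrict (ball y r) ≠ 0 := by
    rw [Ne, Measure.restrict_eq_zero, volume_ball_eq y hr]
    simpa using hpos
  have h1 := eLpNorm_const (p := q) δ (pos_of_gt hq).ne' hne
  rw [Measure.restrict_apply_univ, volume_ball_eq y hr, one_div,
    ENNReal.ofReal_rpow_of_pos hpos, ballVol_rpow q hr, Real.enorm_eq_ofReal hδ0,
    ← ENNReal.ofReal_mul hδ0] at h1
  rw [← h1]
  refine eLpNorm_mono_ae ?_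
  rw [ae_restrict_iff' measurableSet_ball]
  exact ae_of_all _ fun x hx => by rw [Real.norm_of_nonneg hδ0]; exact hδ x hx

/-! ### Coefficients at the intrinsic scale -/

namespace DivFormOperator

lemma bddAbove_r₀_set (L : DivFormOperator n) (q : ℝ≥0∞) (α : ℝ) {rΩ : ℝ} (hrΩ : 0 < rΩ)
    (Ω : Set (EuclideanSpace ℝ (Fin n))) :
    BddAbove {r : ℝ | 0 < r ∧
      ENNReal.ofReal r * (ENNReal.ofReal rΩ⁻¹ + L.coeffSize q α r Ω) ≤ 1} := by
  refine ⟨rΩ, fun r hr => ?_⟩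
  have h1 : ENNReal.ofReal r * ENNReal.ofReal rΩ⁻¹ ≤ 1 :=
    (mul_le_mul_right le_self_add _).trans hr.2
  rw [← ENNReal.ofReal_mul hr.1.le, ENNReal.ofReal_le_one, ← div_eq_mul_inv, div_le_one hrΩ] at h1
  exact h1

/-- The size `‖h‖_{q,r}^σ` of one coefficient at the scale `r = r₀(L, Ω)` is at most `1 / r₀`. The
defining inequality of `r₀` holds for radii below `r₀`, and the norm is left continuous. -/
lemma r₀_mul_ulNorm_rpow_le_one {L : DivFormOperator n} {q : ℝ≥0∞} {α rΩ σ : ℝ}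
    (hσ : 0 < σ) {Ω : Set (EuclideanSpace ℝ (Fin n))} (hΩ : MeasurableSet Ω)
    {h : EuclideanSpace ℝ (Fin n) → F} (hm : AEStronglyMeasurable h (volume.restrict Ω))
    (hle : ∀ r, ulNorm q r Ω h ^ σ ≤ L.coeffSize q α r Ω) :
    L.r₀ q α rΩ Ω * (ulNorm q (L.r₀ q α rΩ Ω) Ω h).toReal ^ σ ≤ 1 := by
  set r₀ := L.r₀ q α rΩ Ω with hr₀
  set M := (ulNorm q r₀ Ω h).toReal ^ σ with hM
  have hM0 : 0 ≤ M := by positivity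
  by_contra! hcon
  have hr₀pos : 0 < r₀ := by
    by_contra! h0
    exact absurd (mul_nonpos_of_nonpos_of_nonneg h0 hM0) (by linarith)
  have hMpos : 0 < M := pos_of_mul_pos_right (zero_lt_one.trans hcon) hr₀pos.le
  -- If `r₀ M > 1`, a radius `s < r₀` still has `s M > 1`; the inequality at radii in `(s, r₀)`
  -- gives `M ≤ 1 / s` in the limit.
  obtain ⟨s, hs1, hs2⟩ := exists_between ((div_lt_iff₀ hMpos).2 hcon)
  have hs0 : 0 < s := lt_trans (by positivity) hs1
  have hne : {r : ℝ | 0 < r ∧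
      ENNReal.ofReal r * (ENNReal.ofReal rΩ⁻¹ + L.coeffSize q α r Ω) ≤ 1}.Nonempty := by
    by_contra! he
    rw [hr₀, DivFormOperator.r₀, he, Real.sSup_empty] at hr₀pos
    exact lt_irrefl _ hr₀pos
  have hN : ulNorm q r₀ Ω h ≤ ((ENNReal.ofReal s)⁻¹) ^ σ⁻¹ := by
    refine ulNorm_le_of_forall_lt hΩ hm fun r hr => ?_
    obtain ⟨t, ⟨ht0, ht1⟩, ht2⟩ := exists_lt_of_lt_csSup hne (max_lt hr hs2)
    refine (ulNorm_mono q ((le_max_left r s).trans ht2.le) Ω h).trans ?_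
    rw [ENNReal.le_rpow_inv_iff hσ, ENNReal.le_inv_iff_mul_le, mul_comm]
    refine le_trans ?_ ht1
    exact mul_le_mul' (ENNReal.ofReal_le_ofReal ((le_max_right r s).trans ht2.le))
      ((hle t).trans le_add_self)
  rw [ENNReal.le_rpow_inv_iff hσ] at hN
  have hM1 : M ≤ s⁻¹ := by
    rw [hM, ENNReal.toReal_rpow]
    refine (ENNReal.toReal_mono (by simpa using hs0) hN).trans ?_
    rw [ENNReal.toReal_inv, ENNReal.toReal_ofReal hs0.le]
  rw [div_lt_iff₀ hMpos] at hs1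
  have := mul_le_mul_of_nonneg_left hM1 hs0.le
  rw [mul_inv_cancel₀ hs0.ne'] at this
  linarith

/-- A coefficient of size at most `K κ^θ` has `‖h‖_{q,r₀}^{1/(θ - n/q)} ≲ κ`: since
`‖h‖_{q,r₀} ≲ κ^θ r₀^{n/q}`, the quantity `M` on the left satisfies
`M^θ = M^{n/q} ‖h‖_{q,r₀} ≲ κ^θ (M r₀)^{n/q} ≤ κ^θ`. The constant does not depend on `q`. -/
lemma ulNorm_r₀_rpow_le (hn : 2 ≤ n) {L : DivFormOperator n} {q : ℝ≥0∞}
    (hq : (n : ℝ≥0∞) < q) {α rΩ θ : ℝ} (hθ : 1 ≤ θ)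
    (hp : ((n : ℝ≥0∞) / q).toReal < 1)
    {Ω : Set (EuclideanSpace ℝ (Fin n))} (hΩ : MeasurableSet Ω)
    {h : EuclideanSpace ℝ (Fin n) → F} (hm : AEStronglyMeasurable h (volume.restrict Ω))
    (hle : ∀ r, ulNorm q r Ω h ^ (1 / (θ - ((n : ℝ≥0∞) / q).toReal)) ≤ L.coeffSize q α r Ω)
    {K κ : ℝ} (hK : 1 ≤ K) (hκ : 0 < κ) (hD : ∀ x ∈ Ω, ‖h x‖ ≤ K * κ ^ θ) :
    (ulNorm q (L.r₀ q α rΩ Ω) Ω h).toReal ^ (1 / (θ - ((n : ℝ≥0∞) / q).toReal)) ≤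
      K * max 1 (unitBallVol n) * κ := by
  set p := ((n : ℝ≥0∞) / q).toReal with hp'
  have hp0 : 0 ≤ p := ENNReal.toReal_nonneg
  have hθp : 0 < θ - p := by linarith
  have hσ : 0 < 1 / (θ - p) := by positivity
  have hM := r₀_mul_ulNorm_rpow_le_one (rΩ := rΩ) hσ hΩ hm hle
  set r₀ := L.r₀ q α rΩ Ω
  set N := (ulNorm q r₀ Ω h).toReal with hN
  have hN0 : 0 ≤ N := ENNReal.toReal_nonneg
  set M := N ^ (1 / (θ - p)) with hMdef
  have hM0 : 0 ≤ M := by positivity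
  have hW : 1 ≤ max 1 (unitBallVol n) := le_max_left _ _
  have hKW : 1 ≤ K * max 1 (unitBallVol n) := one_le_mul_of_one_le_of_one_le hK hW
  rcases hM0.eq_or_lt with hM00 | hMpos
  · rw [← hM00]; positivity
  rcases le_or_gt r₀ 0 with hr | hr
  · have hz : N = 0 := by
      rw [hN, ulNorm]
      simp [ball_eq_empty.2 hr]
    rw [hMdef, hz, Real.zero_rpow hσ.ne'] at hMpos
    exact absurd hMpos (lt_irrefl _)
  have hNle : N ≤ K * κ ^ θ * max 1 (unitBallVol n) * r₀ ^ p := by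
    rw [hN]
    refine ENNReal.toReal_le_of_le_ofReal (by positivity) ?_
    exact ulNorm_le_of_norm_le hn hq hr hΩ (by positivity) hD
  have hNM : N = M ^ (θ - p) := by
    rw [hMdef, ← Real.rpow_mul hN0, one_div_mul_cancel hθp.ne', Real.rpow_one]
  have h1 : M ^ θ ≤ (K * max 1 (unitBallVol n) * κ) ^ θ := by
    calc M ^ θ = N * M ^ p := by rw [hNM, ← Real.rpow_add hMpos, sub_add_cancel]
      _ ≤ K * κ ^ θ * max 1 (unitBallVol n) * r₀ ^ p * M ^ p := by gcongr
      _ = K * max 1 (unitBallVol n) * κ ^ θ * (r₀ * M) ^ p := by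
          rw [Real.mul_rpow hr.le hM0]; ring
      _ ≤ K * max 1 (unitBallVol n) * κ ^ θ * 1 := by
          gcongr
          exact Real.rpow_le_one (by positivity) hM hp0
      _ ≤ (K * max 1 (unitBallVol n)) ^ θ * κ ^ θ := by
          rw [mul_one]
          gcongr
          simpa using Real.rpow_le_rpow_of_exponent_le hKW hθ
      _ = _ := by rw [Real.mul_rpow (by positivity) hκ.le]
  exact (Real.rpow_le_rpow_iff hM0 (by positivity) (by linarith)).1 h1

/-- Coefficients of size `κ i^θ` with `κ i → ∞` have unbounded uniformly local norms at their own
scale `r₀`: a small multiple of `1 / κ i` is admissible in the definition of `r₀`, and on a ball of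
this radius the norm is of order `κ i^{θ - n/q}`. -/
lemma tendsto_ulNorm_r₀ (hn : 2 ≤ n) {L : ℕ → DivFormOperator n} {q : ℝ≥0∞}
    (hq : (n : ℝ≥0∞) < q) {α rΩ θ : ℝ} (hrΩ : 0 < rΩ) (hθ : 1 ≤ θ) (hθ2 : θ ≤ 2)
    (hp : ((n : ℝ≥0∞) / q).toReal < 1)
    {Ω : Set (EuclideanSpace ℝ (Fin n))} (hΩ : MeasurableSet Ω)
    {h : ℕ → EuclideanSpace ℝ (Fin n) → F} {Z : ℝ} (hZ : 0 ≤ Z)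
    (hle : ∀ i r, (L i).coeffSize q α r Ω ≤
      ulNorm q r Ω (h i) ^ (1 / (θ - ((n : ℝ≥0∞) / q).toReal)) + ENNReal.ofReal Z)
    {K δ ρ : ℝ} {κ : ℕ → ℝ} (hK : 1 ≤ K) (hδ : 0 < δ) (hρ : 0 < ρ) (hκ : Tendsto κ atTop atTop)
    (hD : ∀ i, ∀ x ∈ Ω, ‖h i x‖ ≤ K * κ i ^ θ) {y : EuclideanSpace ℝ (Fin n)} (hy : ball y ρ ⊆ Ω)
    (hlow : ∀ᶠ i in atTop, ∀ x ∈ ball y ρ, δ * κ i ^ θ ≤ ‖h i x‖) :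
    Tendsto (fun i => (ulNorm q ((L i).r₀ q α rΩ Ω) Ω (h i)).toReal) atTop atTop := by
  set p := ((n : ℝ≥0∞) / q).toReal with hp'
  have hp0 : 0 ≤ p := ENNReal.toReal_nonneg
  have hθp : 0 < θ - p := by linarith
  have hσ : 0 < 1 / (θ - p) := by positivity
  set W := max 1 (unitBallVol n) with hWdef
  have hW : 1 ≤ W := le_max_left _ _
  have hKW : 1 ≤ K * W := one_le_mul_of_one_le_of_one_le hK hW
  -- The constant `s` makes the contribution of `h i` at the scale `s / κ i` at most `1 / 2`.
  set s : ℝ := 1 / (4 * (K * W)) with hs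
  have hs0 : 0 < s := by positivity
  have hs1 : s ≤ 1 := by
    rw [hs, div_le_one (by positivity)]; linarith
  have hsθ : K * W * s ^ θ ≤ 1 / 4 := by
    calc K * W * s ^ θ ≤ K * W * s := by
          gcongr
          simpa using Real.rpow_le_rpow_of_exponent_ge hs0 hs1 hθ
      _ = 1 / 4 := by rw [hs]; field_simp
  have hr0 : Tendsto (fun i => s / κ i) atTop (𝓝 0) := hκ.const_div_atTop s
  have hrZ : Tendsto (fun i => s / κ i * (rΩ⁻¹ + Z)) atTop (𝓝 0) := by
    simpa using hr0.mul_const (rΩ⁻¹ + Z)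
  have hV := Real.rpow_pos_of_pos (unitBallVol_pos (n := n)) q.toReal⁻¹
  have hmain : Tendsto (fun i => δ * (s ^ p * unitBallVol n ^ q.toReal⁻¹) * κ i ^ (θ - p))
      atTop atTop :=
    ((tendsto_rpow_atTop hθp).comp hκ).const_mul_atTop (by positivity)
  refine tendsto_atTop_mono' _ ?_ hmain
  filter_upwards [hlow, hκ.eventually_gt_atTop 0, hr0.eventually (gt_mem_nhds hρ),
    hrZ.eventually (gt_mem_nhds (show (0 : ℝ) < 1 / 2 by norm_num))] with i hlow hκi hri hrZi
  set r := s / κ i with hr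
  have hrpos : 0 < r := by positivity
  have hκr : κ i = s / r := by rw [hr]; field_simp
  have hup : ∀ t, 0 < t → ulNorm q t Ω (h i) ≤ ENNReal.ofReal (K * κ i ^ θ * W * t ^ p) :=
    fun t ht => ulNorm_le_of_norm_le hn hq ht hΩ (by positivity) (hD i)
  have hmem : r ∈ {r : ℝ | 0 < r ∧
      ENNReal.ofReal r * (ENNReal.ofReal rΩ⁻¹ + (L i).coeffSize q α r Ω) ≤ 1} := by
    refine ⟨hrpos, ?_⟩
    have h1 : ulNorm q r Ω (h i) ^ (1 / (θ - p)) ≤ ENNReal.ofReal (1 / 2 * r⁻¹) := by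
      refine (ENNReal.rpow_le_rpow (hup r hrpos) hσ.le).trans ?_
      rw [ENNReal.ofReal_rpow_of_nonneg (by positivity) hσ.le]
      refine ENNReal.ofReal_le_ofReal ?_
      have e1 : K * κ i ^ θ * W * r ^ p = K * W * s ^ θ * (r⁻¹) ^ (θ - p) := by
        rw [hκr, Real.div_rpow hs0.le hrpos.le, Real.inv_rpow hrpos.le, Real.rpow_sub hrpos]
        have := Real.rpow_pos_of_pos hrpos θ
        have := Real.rpow_pos_of_pos hrpos p
        field_simp
      rw [e1, Real.mul_rpow (by positivity) (by positivity), ← Real.rpow_mul (by positivity),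
        mul_one_div_cancel hθp.ne', Real.rpow_one]
      gcongr
      calc (K * W * s ^ θ) ^ (1 / (θ - p)) ≤ (1 / 4 : ℝ) ^ (1 / (θ - p)) := by gcongr
        _ ≤ (1 / 4 : ℝ) ^ (1 / 2 : ℝ) := by
            refine Real.rpow_le_rpow_of_exponent_ge (by norm_num) (by norm_num) ?_
            exact one_div_le_one_div_of_le hθp (by linarith)
        _ = 1 / 2 := by
            rw [← Real.sqrt_eq_rpow, show (1 / 4 : ℝ) = (1 / 2) ^ 2 by norm_num,
              Real.sqrt_sq (by norm_num)]
    have h2 : ENNReal.ofReal rΩ⁻¹ + (L i).coeffSize q α r Ω ≤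
        ENNReal.ofReal (rΩ⁻¹ + (1 / 2 * r⁻¹ + Z)) := by
      rw [ENNReal.ofReal_add (by positivity) (by positivity),
        ENNReal.ofReal_add (by positivity) hZ]
      gcongr
      exact (hle i r).trans (by gcongr)
    refine (mul_le_mul_right h2 _).trans ?_
    rw [← ENNReal.ofReal_mul hrpos.le, ENNReal.ofReal_le_one]
    calc r * (rΩ⁻¹ + (1 / 2 * r⁻¹ + Z)) = r * (rΩ⁻¹ + Z) + 1 / 2 := by field_simp; ring
      _ ≤ 1 := by linarith
  have hle₀ : r ≤ (L i).r₀ q α rΩ Ω := le_csSup ((L i).bddAbove_r₀_set q α hrΩ Ω) hmem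
  have hfin : ulNorm q ((L i).r₀ q α rΩ Ω) Ω (h i) ≠ ⊤ :=
    ne_top_of_le_ne_top ENNReal.ofReal_ne_top (hup _ (hrpos.trans_le hle₀))
  have h3 := (le_ulNorm_of_le_norm hq hrpos ((ball_subset_ball hri.le).trans hy)
    (show 0 ≤ δ * κ i ^ θ by positivity)
    fun x hx => hlow x (ball_subset_ball hri.le hx)).trans (ulNorm_mono q hle₀ Ω (h i))
  refine le_trans (le_of_eq ?_) ((ENNReal.ofReal_le_iff_le_toReal hfin).1 h3)
  rw [hr, Real.div_rpow hs0.le hκi.le, Real.rpow_sub hκi]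
  ring

end DivFormOperator

end Norms

/-! ### Calculus of radial functions -/

section Radial

variable {E : Type*} [NormedAddCommGroup E] [InnerProductSpace ℝ E]

lemma hasFDerivAt_comp_norm_sq {f : ℝ → ℝ} {f' : ℝ} {x : E} (hf : HasDerivAt f f' (‖x‖ ^ 2)) :
    HasFDerivAt (fun y : E => f (‖y‖ ^ 2)) ((2 * f') • innerSL ℝ x) x := by
  have h := hf.comp_hasFDerivAt x (hasStrictFDerivAt_norm_sq x).hasFDerivAt
  rwa [← Nat.cast_smul_eq_nsmul ℝ, smul_smul, mul_comm, Nat.cast_ofNat] at h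

lemma gradient_comp_norm_sq [CompleteSpace E] {f : ℝ → ℝ} {f' : ℝ} {x : E}
    (hf : HasDerivAt f f' (‖x‖ ^ 2)) :
    gradient (fun y : E => f (‖y‖ ^ 2)) x = (2 * f') • x := by
  refine HasGradientAt.gradient ?_
  rw [hasGradientAt_iff_hasFDerivAt]
  have e : InnerProductSpace.toDual ℝ E ((2 * f') • x) = (2 * f') • innerSL ℝ x := by
    ext v
    simp
  rw [e]
  exact hasFDerivAt_comp_norm_sq hf

lemma laplacian_comp_norm_sq [FiniteDimensional ℝ E] {f f' f'' : ℝ → ℝ}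
    (hf : ∀ t, HasDerivAt f (f' t) t) (hf' : ∀ t, HasDerivAt f' (f'' t) t) (x : E) :
    Laplacian.laplacian (fun y : E => f (‖y‖ ^ 2)) x =
      4 * ‖x‖ ^ 2 * f'' (‖x‖ ^ 2) + 2 * Module.finrank ℝ E * f' (‖x‖ ^ 2) := by
  have h1 : fderiv ℝ (fun y : E => f (‖y‖ ^ 2)) = fun y => (2 * f' (‖y‖ ^ 2)) • innerSL ℝ y :=
    funext fun y => (hasFDerivAt_comp_norm_sq (hf _)).fderiv
  have h2 := ((hasFDerivAt_comp_norm_sq (x := x) (hf' _)).const_mul (2 : ℝ)).smul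
    (innerSL ℝ (E := E)).hasFDerivAt
  have h3 : ∀ v : E, iteratedFDeriv ℝ 2 (fun y : E => f (‖y‖ ^ 2)) x ![v, v] =
      4 * f'' (‖x‖ ^ 2) * inner ℝ x v ^ 2 + 2 * f' (‖x‖ ^ 2) * ‖v‖ ^ 2 := by
    intro v
    rw [iteratedFDeriv_two_apply, h1]
    refine (DFunLike.congr_fun (DFunLike.congr_fun h2.fderiv v) v).trans ?_
    change 2 * f' (‖x‖ ^ 2) * inner ℝ v v +
      2 * (2 * f'' (‖x‖ ^ 2) * inner ℝ x v) * inner ℝ x v = _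
    rw [real_inner_self_eq_norm_sq]
    ring
  rw [InnerProductSpace.laplacian_eq_iteratedFDeriv_stdOrthonormalBasis]
  simp only [h3, Finset.sum_add_distrib, ← Finset.mul_sum, OrthonormalBasis.norm_eq_one,
    OrthonormalBasis.sum_sq_inner_left]
  simp
  ring

end Radial

/-! ### The explicit solutions -/

/-- The exponent `a t + m t² / 2`, with derivative `a + m t`. -/
def quadExponent (a m t : ℝ) : ℝ := a * t + m / 2 * t ^ 2

/-- The radial function `(1 - t) exp (-(a t + m t² / 2))` of `t = |x|² / R²`. It is smooth, positive
in `B_R` and vanishes on the boundary of `B_R`. -/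
def dampedBump {n : ℕ} (R a m : ℝ) (x : EuclideanSpace ℝ (Fin n)) : ℝ :=
  (1 - ‖x‖ ^ 2 / R ^ 2) * Real.exp (-quadExponent a m (‖x‖ ^ 2 / R ^ 2))

/-- `-exp (quadExponent a m t)` times the `t`-derivative of the profile of `dampedBump`. -/
def bumpSlope (a m t : ℝ) : ℝ := 1 + (1 - t) * (a + m * t)

lemma hasDerivAt_quadExponent (a m t : ℝ) : HasDerivAt (quadExponent a m) (a + m * t) t := by
  have := ((hasDerivAt_id t).const_mul a).add (((hasDerivAt_id t).pow 2).const_mul (m / 2))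
  refine this.congr_deriv ?_
  simp
  ring

lemma hasDerivAt_bumpSlope (a m t : ℝ) :
    HasDerivAt (bumpSlope a m) (-(a + m * t) + (1 - t) * m) t := by
  have := (((hasDerivAt_id t).const_sub 1).mul
    (((hasDerivAt_id t).const_mul m).const_add a)).const_add 1
  refine this.congr_deriv ?_
  simp

lemma hasDerivAt_bumpProfile (a m t : ℝ) :
    HasDerivAt (fun t => (1 - t) * Real.exp (-quadExponent a m t))
      (-bumpSlope a m t * Real.exp (-quadExponent a m t)) t := by
  have := ((hasDerivAt_id t).const_sub 1).mul (hasDerivAt_quadExponent a m t).neg.exp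
  refine this.congr_deriv ?_
  simp only [id, bumpSlope, Pi.neg_apply]
  ring

lemma hasDerivAt_bumpProfile_deriv (a m t : ℝ) :
    HasDerivAt (fun t => -bumpSlope a m t * Real.exp (-quadExponent a m t))
      (((a + m * t) * bumpSlope a m t - (-(a + m * t) + (1 - t) * m)) *
        Real.exp (-quadExponent a m t)) t := by
  have := (hasDerivAt_bumpSlope a m t).neg.mul (hasDerivAt_quadExponent a m t).neg.exp
  refine this.congr_deriv ?_
  simp only [Pi.neg_apply]
  ring

lemma gradient_dampedBump (R a m : ℝ) (x : EuclideanSpace ℝ (Fin n)) :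
    gradient (dampedBump R a m) x =
      (-(2 / R ^ 2 * bumpSlope a m (‖x‖ ^ 2 / R ^ 2) *
        Real.exp (-quadExponent a m (‖x‖ ^ 2 / R ^ 2)))) • x := by
  have h := (hasDerivAt_bumpProfile a m (‖x‖ ^ 2 / R ^ 2)).comp (‖x‖ ^ 2)
    ((hasDerivAt_id _).div_const (R ^ 2))
  refine (gradient_comp_norm_sq h).trans ?_
  congr 1
  ring

lemma laplacian_dampedBump (R a m : ℝ) (x : EuclideanSpace ℝ (Fin n)) (t : ℝ)
    (ht : t = ‖x‖ ^ 2 / R ^ 2) :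
    Laplacian.laplacian (dampedBump R a m) x =
      (R ^ 2)⁻¹ * Real.exp (-quadExponent a m t) *
        (4 * t * ((a + m * t) * bumpSlope a m t - (-(a + m * t) + (1 - t) * m))
          - 2 * n * bumpSlope a m t) := by
  have h1 := fun s => (hasDerivAt_bumpProfile a m (s / R ^ 2)).comp s
    ((hasDerivAt_id s).div_const (R ^ 2))
  have h2 := fun s => ((hasDerivAt_bumpProfile_deriv a m (s / R ^ 2)).comp s
    ((hasDerivAt_id s).div_const (R ^ 2))).mul_const (1 / R ^ 2)
  refine (laplacian_comp_norm_sq h1 h2 x).trans ?_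
  rw [finrank_euclideanSpace, Fintype.card_fin, ht]
  ring

lemma contDiff_dampedBump (R a m : ℝ) {k : ℕ∞ω} :
    ContDiff ℝ k (dampedBump R a m : EuclideanSpace ℝ (Fin n) → ℝ) := by
  have h : ContDiff ℝ k fun x : EuclideanSpace ℝ (Fin n) => ‖x‖ ^ 2 / R ^ 2 :=
    (contDiff_norm_sq ℝ).div_const _
  unfold dampedBump quadExponent
  fun_prop

lemma infDist_sphere_zero [NeZero n] {R : ℝ} {x : EuclideanSpace ℝ (Fin n)}
    (hx : ‖x‖ ≤ R) : infDist x (sphere (0 : EuclideanSpace ℝ (Fin n)) R) = R - ‖x‖ := by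
  have hR : 0 ≤ R := (norm_nonneg x).trans hx
  obtain ⟨e, he, hxe⟩ : ∃ e : EuclideanSpace ℝ (Fin n), ‖e‖ = 1 ∧ x = ‖x‖ • e := by
    rcases eq_or_ne x 0 with rfl | hx0
    · exact ⟨EuclideanSpace.single 0 1, by simp, by simp⟩
    · exact ⟨‖x‖⁻¹ • x, norm_smul_inv_norm hx0, by
        rw [smul_smul, mul_inv_cancel₀ (norm_ne_zero_iff.2 hx0), one_smul]⟩
  have hz : R • e ∈ sphere (0 : EuclideanSpace ℝ (Fin n)) R := by
    simp [norm_smul, he, abs_of_nonneg hR]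
  refine le_antisymm ((infDist_le_dist_of_mem hz).trans (le_of_eq ?_)) ?_
  · nth_rewrite 1 [hxe]
    rw [dist_eq_norm, ← sub_smul, norm_smul, he, mul_one, Real.norm_eq_abs, abs_sub_comm,
      abs_of_nonneg (by linarith)]
  · refine (le_infDist ⟨_, hz⟩).2 fun y hy => ?_
    rw [mem_sphere_zero_iff_norm] at hy
    rw [dist_comm, dist_eq_norm, ← hy]
    exact norm_sub_norm_le y x

/-! ### Boundary quotients and logarithmic gradients -/

lemma sq_div_sq_mem_Ico {R ρ : ℝ} (hρ : 0 ≤ ρ) (h : ρ < R) : ρ ^ 2 / R ^ 2 ∈ Ico (0 : ℝ) 1 :=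
  ⟨by positivity, by
    have : 0 < R := hρ.trans_lt h
    rw [div_lt_one (by positivity)]; gcongr⟩

lemma quadExponent_nonneg {a m t : ℝ} (ha : 0 ≤ a) (ham : 0 ≤ a + m) (h0 : 0 ≤ t) (h1 : t ≤ 1) :
    0 ≤ quadExponent a m t := by
  have : quadExponent a m t = t * (a * (1 - t / 2) + (a + m) * (t / 2)) := by
    rw [quadExponent]; ring
  rw [this]
  have : 0 ≤ 1 - t / 2 := by linarith
  positivity

lemma quadExponent_le {a m t : ℝ} (ha : 0 ≤ a) (h0 : 0 ≤ t) (h1 : t ≤ 1) :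
    quadExponent a m t ≤ a + |m| := by
  rw [quadExponent]
  have e1 : a * t ≤ a := mul_le_of_le_one_right ha h1
  have e2 : m / 2 * t ^ 2 ≤ |m| * 1 := by
    refine mul_le_mul ?_ (pow_le_one₀ h0 h1) (by positivity) (abs_nonneg m)
    have := le_abs_self m
    have := abs_nonneg m
    linarith
  linarith

lemma dampedBump_div_infDist [NeZero n] {R : ℝ} (a m : ℝ) {x : EuclideanSpace ℝ (Fin n)}
    (hx : ‖x‖ < R) :
    dampedBump R a m x / infDist x (frontier (ball (0 : EuclideanSpace ℝ (Fin n)) R)) =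
      (R + ‖x‖) / R ^ 2 * Real.exp (-quadExponent a m (‖x‖ ^ 2 / R ^ 2)) := by
  have hR : 0 < R := (norm_nonneg x).trans_lt hx
  rw [frontier_ball _ hR.ne', infDist_sphere_zero hx.le, dampedBump]
  have : R - ‖x‖ ≠ 0 := by linarith
  field_simp
  ring

lemma isPositiveDirichletSolution_dampedBump {R : ℝ} (hR : 0 < R) (a m : ℝ)
    {b : EuclideanSpace ℝ (Fin n) → EuclideanSpace ℝ (Fin n)} {c : EuclideanSpace ℝ (Fin n) → ℝ}
    (heq : ∀ x ∈ ball (0 : EuclideanSpace ℝ (Fin n)) R,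
      -(Laplacian.laplacian (dampedBump R a m) x) + inner ℝ (b x) (gradient (dampedBump R a m) x)
        + c x * dampedBump R a m x = 0) :
    IsPositiveDirichletSolution R b c (dampedBump R a m) where
  contDiffOn := (contDiff_dampedBump R a m).contDiffOn
  continuousOn := (contDiff_dampedBump R a m (k := 0)).continuous.continuousOn
  pos x hx := by
    have := (sq_div_sq_mem_Ico (norm_nonneg x) (mem_ball_zero_iff.1 hx)).2
    exact mul_pos (by linarith) (Real.exp_pos _)
  boundary x hx := by
    rw [frontier_ball _ hR.ne', mem_sphere_zero_iff_norm] at hx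
    rw [dampedBump, hx, div_self (by positivity), sub_self, zero_mul]
  equation := heq

/-- The quotients `u / d` of `u = dampedBump R a m` are comparable to
`exp (-quadExponent a m t) / R`, which drops at least by the factor `exp (-k / 32)` from the centre
to the sphere `|x| = R / 2`, where the logarithmic gradient is at least `k / (4 R)`. -/
lemma harnackLowerBounds_dampedBump [NeZero n] {R a m k K M : ℝ} (hR : 0 < R) (ha : 0 ≤ a)
    (ham : 0 ≤ a + m) (hk : 0 ≤ k) (h1 : k / 32 ≤ quadExponent a m (1 / 4))
    (h2 : k / 4 ≤ a + m / 4) (hK : 1 ≤ K) (hM : M ≤ K * (k / R)) :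
    HarnackLowerBounds R (1 / (32 * K)) M
      (dampedBump R a m : EuclideanSpace ℝ (Fin n) → ℝ) := by
  set u : EuclideanSpace ℝ (Fin n) → ℝ := dampedBump R a m with hu
  have hquarter : ∀ x : EuclideanSpace ℝ (Fin n), ‖x‖ = R / 2 → ‖x‖ ^ 2 / R ^ 2 = 1 / 4 := by
    intro x hx
    rw [hx]; field_simp; norm_num
  have hub : ∀ v ∈ distQuotients R u, v ≤ 2 / R := by
    rintro _ ⟨x, hx, rfl⟩
    rw [mem_ball_zero_iff] at hx
    have ht := sq_div_sq_mem_Ico (norm_nonneg x) hx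
    simp only [hu, dampedBump_div_infDist a m hx]
    have e1 : Real.exp (-quadExponent a m (‖x‖ ^ 2 / R ^ 2)) ≤ 1 :=
      Real.exp_le_one_iff.2 (neg_nonpos.2 (quadExponent_nonneg ha ham ht.1 ht.2.le))
    calc _ ≤ (R + R) / R ^ 2 * 1 := by gcongr
      _ = 2 / R := by field_simp; ring
  have hlb : ∀ v ∈ distQuotients R u, 1 / R * Real.exp (-(a + |m|)) ≤ v := by
    rintro _ ⟨x, hx, rfl⟩
    rw [mem_ball_zero_iff] at hx
    have ht := sq_div_sq_mem_Ico (norm_nonneg x) hx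
    simp only [hu, dampedBump_div_infDist a m hx]
    refine mul_le_mul ?_ ?_ (Real.exp_pos _).le (by positivity)
    · rw [div_le_div_iff₀ hR (by positivity)]
      nlinarith [norm_nonneg x]
    · exact Real.exp_le_exp.2 (neg_le_neg (quadExponent_le ha ht.1 ht.2.le))
  have h0 : 1 / R ∈ distQuotients R u := by
    refine ⟨0, mem_ball_self hR, ?_⟩
    simp only [hu]
    rw [dampedBump_div_infDist a m (by simpa using hR)]
    simp [quadExponent]
    field_simp
  have hhalf : 3 / (2 * R) * Real.exp (-quadExponent a m (1 / 4)) ∈ distQuotients R u := by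
    have hx : ‖EuclideanSpace.single (0 : Fin n) (R / 2)‖ = R / 2 := by
      simp [abs_of_pos hR]
    have hxR : ‖EuclideanSpace.single (0 : Fin n) (R / 2)‖ < R := by rw [hx]; linarith
    refine ⟨EuclideanSpace.single 0 (R / 2), mem_ball_zero_iff.2 hxR, ?_⟩
    simp only [hu]
    rw [dampedBump_div_infDist a m hxR, hquarter _ hx, hx]
    congr 1
    field_simp
    ring
  have hbdd : BddAbove (distQuotients R u) := ⟨_, hub⟩
  have hinf : 0 < sInf (distQuotients R u) :=
    lt_of_lt_of_le (by positivity) (le_csInf ⟨_, h0⟩ hlb)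
  refine ⟨hbdd, hinf, ?_, fun x hx => ?_⟩
  · have hsup := le_csSup hbdd h0
    have hle := csInf_le (⟨_, hlb⟩ : BddBelow (distQuotients R u)) hhalf
    have hle' : sInf (distQuotients R u) ≤ 3 / (2 * R) * Real.exp (-(k / 32)) :=
      hle.trans (by gcongr)
    have hexp : 1 / (32 * K) * M * R ≤ k / 32 := by
      calc 1 / (32 * K) * M * R ≤ 1 / (32 * K) * (K * (k / R)) * R := by gcongr
        _ = k / 32 := by field_simp
    have hC : 1 / (32 * K) ≤ 2 / 3 := by
      rw [div_le_div_iff₀ (by positivity) (by norm_num)]; linarith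
    rw [le_div_iff₀ hinf]
    calc 1 / (32 * K) * Real.exp (1 / (32 * K) * M * R) * sInf (distQuotients R u)
        ≤ 2 / 3 * Real.exp (k / 32) * (3 / (2 * R) * Real.exp (-(k / 32))) := by gcongr
      _ = 1 / R := by rw [Real.exp_neg]; field_simp
      _ ≤ _ := hsup
  · rw [hu, gradient_dampedBump, norm_smul, dampedBump, hquarter x hx, hx, norm_neg, norm_mul,
      Real.norm_of_nonneg (Real.exp_pos _).le, le_div_iff₀ (by positivity)]
    have e1 : 1 / (32 * K) * M ≤ k / (32 * R) := by
      calc 1 / (32 * K) * M ≤ 1 / (32 * K) * (K * (k / R)) := by gcongr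
        _ = _ := by field_simp
    have e2 : 3 / 4 * (k / 4) ≤ bumpSlope a m (1 / 4) := by
      rw [bumpSlope]; linarith
    calc 1 / (32 * K) * M * ((1 - 1 / 4) * Real.exp (-quadExponent a m (1 / 4)))
        ≤ k / (32 * R) * ((1 - 1 / 4) * Real.exp (-quadExponent a m (1 / 4))) := by
          gcongr
      _ ≤ 2 / R ^ 2 * (3 / 4 * (k / 4)) * Real.exp (-quadExponent a m (1 / 4)) * (R / 2) := by
          have := Real.exp_pos (-quadExponent a m (1 / 4))
          have e3 : 2 / R ^ 2 * (3 / 4 * (k / 4)) * Real.exp (-quadExponent a m (1 / 4)) * (R / 2)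
            = 8 * (k / (32 * R) * ((1 - 1 / 4) * Real.exp (-quadExponent a m (1 / 4)))) := by
            field_simp; ring
          rw [e3]
          exact le_mul_of_one_le_left (mul_nonneg (by positivity) (by norm_num; positivity))
            (by norm_num)
      _ ≤ ‖2 / R ^ 2 * bumpSlope a m (1 / 4)‖ * Real.exp (-quadExponent a m (1 / 4)) * (R / 2) := by
          gcongr
          exact le_trans (by gcongr) (le_abs_self _)

/-! ### Coefficient sizes of the two operators -/

lemma ulHolder_const {F : Type*} [NormedAddCommGroup F] (α r : ℝ)
    (Ω : Set (EuclideanSpace ℝ (Fin n))) (v : F) : ulHolder α r Ω (fun _ => v) = 0 := by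
  simp [ulHolder]

lemma ulNorm_zero {F : Type*} [NormedAddCommGroup F] (q : ℝ≥0∞) (r : ℝ)
    (Ω : Set (EuclideanSpace ℝ (Fin n))) : ulNorm q r Ω (fun _ => (0 : F)) = 0 := by
  simp [ulNorm]

lemma ulNorm_neg {F : Type*} [NormedAddCommGroup F] (q : ℝ≥0∞) (r : ℝ)
    (Ω : Set (EuclideanSpace ℝ (Fin n))) (h : EuclideanSpace ℝ (Fin n) → F) :
    ulNorm q r Ω (fun x => -h x) = ulNorm q r Ω h :=
  iSup_congr fun _ => iSup_congr fun _ => eLpNorm_neg h _ _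

lemma ulNorm_le_eLpNorm {F : Type*} [NormedAddCommGroup F] (q : ℝ≥0∞) (r : ℝ)
    (Ω : Set (EuclideanSpace ℝ (Fin n))) (h : EuclideanSpace ℝ (Fin n) → F) :
    ulNorm q r Ω h ≤ eLpNorm h q (volume.restrict Ω) :=
  iSup₂_le fun _ _ => eLpNorm_mono_measure _ (Measure.restrict_mono inter_subset_left le_rfl)

lemma betaExp_pos {q : ℝ≥0∞} (hp : ((n : ℝ≥0∞) / q).toReal < 1) : 0 < betaExp n q :=
  one_div_pos.2 (by linarith)

lemma gammaExp_pos {q : ℝ≥0∞} (hp : ((n : ℝ≥0∞) / q).toReal < 1) : 0 < gammaExp n q :=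
  one_div_pos.2 (by linarith)

lemma coeffSize_schrodingerOp {q : ℝ≥0∞} (hp : ((n : ℝ≥0∞) / q).toReal < 1) {α : ℝ} (hα : 0 < α)
    (r : ℝ) (Ω : Set (EuclideanSpace ℝ (Fin n))) (c : EuclideanSpace ℝ (Fin n) → ℝ) :
    (schrodingerOp c).coeffSize q α r Ω = ulNorm q r Ω c ^ gammaExp n q := by
  simp only [DivFormOperator.coeffSize, schrodingerOp, eLpNorm_zero', ulHolder_const,
    ulNorm_zero, ulNorm_neg]
  rw [ENNReal.zero_rpow_of_pos (by positivity), ENNReal.zero_rpow_of_pos (by positivity),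
    ENNReal.zero_rpow_of_pos (betaExp_pos hp)]
  simp

lemma coeffSize_driftOp {q : ℝ≥0∞} {α : ℝ} (hα : 0 < α)
    (r : ℝ) (Ω : Set (EuclideanSpace ℝ (Fin n)))
    (b : EuclideanSpace ℝ (Fin n) → EuclideanSpace ℝ (Fin n)) (μ : ℝ) :
    (driftOp b μ).coeffSize q α r Ω =
      ulNorm q r Ω b ^ betaExp n q + ulNorm q r Ω (fun _ => μ) ^ gammaExp n q := by
  simp only [DivFormOperator.coeffSize, driftOp, eLpNorm_zero', ulHolder_const, ulNorm_neg]
  rw [ENNReal.zero_rpow_of_pos (by positivity), ENNReal.zero_rpow_of_pos (by positivity)]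
  simp

/-! ### The potential and the drift -/

/-- The potential `c`, scaled by `R²` and as a function of `t = |x|² / R²`, for which
`dampedBump R (n / 4 + k) (-k)` solves `Δ u = c u`. -/
def potentialProfile (n : ℕ) (k t : ℝ) : ℝ :=
  4 * t * ((n / 4 + k * (1 - t)) ^ 2 + k) - 2 * n * (n / 4 + k * (1 - t)) - 2 * n + 8 * k * t

/-- The potential `c` with `Δ u = c u` for `u = dampedBump R (n / 4 + k) (-k)`. -/
def potential (R k : ℝ) (x : EuclideanSpace ℝ (Fin n)) : ℝ :=
  (R ^ 2)⁻¹ * potentialProfile n k (‖x‖ ^ 2 / R ^ 2)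

/-- The factor `β` such that the drift `β(t) x / R²`, with `t = |x|² / R²`, is the one for which
`dampedBump R 1 k` solves the equation with the zeroth order constant `4 n / R²`. -/
def driftProfile (n : ℕ) (k t : ℝ) : ℝ :=
  -2 * (1 + k * t) + (2 * (k - 1 - 2 * k * t) + n * (k + 1) - n * k * t) / bumpSlope 1 k t

/-- The radial drift `b` with `-Δ u + b · ∇u = (4 n / R²) u` for `u = dampedBump R 1 k`. -/
def drift (R k : ℝ) (x : EuclideanSpace ℝ (Fin n)) : EuclideanSpace ℝ (Fin n) :=
  ((R ^ 2)⁻¹ * driftProfile n k (‖x‖ ^ 2 / R ^ 2)) • x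

lemma potential_equation (R k : ℝ) (x : EuclideanSpace ℝ (Fin n)) :
    -(Laplacian.laplacian (dampedBump R (n / 4 + k) (-k)) x)
      + inner ℝ 0 (gradient (dampedBump R (n / 4 + k) (-k)) x)
      + potential R k x * dampedBump R (n / 4 + k) (-k) x = 0 := by
  rw [laplacian_dampedBump _ _ _ x _ rfl, inner_zero_left, potential, potentialProfile, dampedBump,
    bumpSlope]
  ring

lemma one_le_bumpSlope {k t : ℝ} (hk : 0 ≤ k) (h0 : 0 ≤ t) (h1 : t ≤ 1) : 1 ≤ bumpSlope 1 k t := by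
  have : 0 ≤ (1 - t) * (1 + k * t) := mul_nonneg (by linarith) (by positivity)
  rw [bumpSlope]
  linarith

lemma drift_equation {R k : ℝ} (hk : 0 ≤ k) {x : EuclideanSpace ℝ (Fin n)}
    (hx : x ∈ ball (0 : EuclideanSpace ℝ (Fin n)) R) :
    -(Laplacian.laplacian (dampedBump R 1 k) x)
      + inner ℝ (drift R k x) (gradient (dampedBump R 1 k) x)
      + -(4 * n * (R ^ 2)⁻¹) * dampedBump R 1 k x = 0 := by
  have ht := sq_div_sq_mem_Ico (norm_nonneg x) (mem_ball_zero_iff.1 hx)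
  have hP := (one_le_bumpSlope hk ht.1 ht.2.le)
  rw [laplacian_dampedBump _ _ _ x _ rfl, gradient_dampedBump, drift, real_inner_smul_left,
    real_inner_smul_right, real_inner_self_eq_norm_sq, dampedBump, driftProfile]
  set t := ‖x‖ ^ 2 / R ^ 2 with htdef
  have hx2 : 2 / R ^ 2 * ‖x‖ ^ 2 = 2 * t := by rw [htdef]; ring
  have hP0 : bumpSlope 1 k t ≠ 0 := by linarith
  set X := 2 * (k - 1 - 2 * k * t) + n * (k + 1) - n * k * t with hX
  have hXP : X / bumpSlope 1 k t * bumpSlope 1 k t = X := div_mul_cancel₀ _ hP0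
  set Q := X / bumpSlope 1 k t
  set e := Real.exp (-quadExponent 1 k t)
  have hslope : bumpSlope 1 k t = 1 + (1 - t) * (1 + k * t) := rfl
  calc _ = (R ^ 2)⁻¹ * e * (-(4 * t * ((1 + k * t) * bumpSlope 1 k t
            - (-(1 + k * t) + (1 - t) * k)) - 2 * n * bumpSlope 1 k t)
          + (2 * (1 + k * t) * bumpSlope 1 k t - Q * bumpSlope 1 k t) * (2 / R ^ 2 * ‖x‖ ^ 2)
          - 4 * n * (1 - t)) := by ring
    _ = 0 := by
        rw [hx2, hXP, hX, hslope]
        ring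

lemma contDiff_potential (R k : ℝ) :
    ContDiff ℝ ∞ (potential R k : EuclideanSpace ℝ (Fin n) → ℝ) := by
  have h : ContDiff ℝ ∞ fun x : EuclideanSpace ℝ (Fin n) => ‖x‖ ^ 2 / R ^ 2 :=
    (contDiff_norm_sq ℝ).div_const _
  unfold potential potentialProfile
  fun_prop

lemma contDiffOn_drift {R k : ℝ} (hR : 0 < R) (hk : 0 ≤ k) :
    ContDiffOn ℝ ∞ (drift R k) (closedBall (0 : EuclideanSpace ℝ (Fin n)) R) := by
  have h : ContDiff ℝ ∞ fun x : EuclideanSpace ℝ (Fin n) => ‖x‖ ^ 2 / R ^ 2 :=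
    (contDiff_norm_sq ℝ).div_const _
  have hP : ContDiff ℝ ∞ fun x : EuclideanSpace ℝ (Fin n) => bumpSlope 1 k (‖x‖ ^ 2 / R ^ 2) := by
    unfold bumpSlope
    fun_prop
  have hX : ContDiff ℝ ∞ fun x : EuclideanSpace ℝ (Fin n) =>
      2 * (k - 1 - 2 * k * (‖x‖ ^ 2 / R ^ 2)) + n * (k + 1) - n * k * (‖x‖ ^ 2 / R ^ 2) := by
    fun_prop
  have hL : ContDiff ℝ ∞ fun x : EuclideanSpace ℝ (Fin n) => -2 * (1 + k * (‖x‖ ^ 2 / R ^ 2)) := by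
    fun_prop
  refine ContDiffOn.smul (contDiffOn_const.mul
    (hL.contDiffOn.add (hX.contDiffOn.div hP.contDiffOn fun x hx => ?_))) contDiffOn_id
  rw [mem_closedBall_zero_iff] at hx
  have := one_le_bumpSlope (t := ‖x‖ ^ 2 / R ^ 2) hk (by positivity) (by
    rw [div_le_one (by positivity)]; gcongr)
  linarith

lemma abs_potentialProfile_le (hn : 2 ≤ n) {k t : ℝ} (hk : 1 ≤ k) (h0 : 0 ≤ t) (h1 : t ≤ 1) :
    |potentialProfile n k t| ≤ 20 * n ^ 2 * k ^ 2 := by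
  have hν : (2 : ℝ) ≤ n := by exact_mod_cast hn
  rw [potentialProfile]
  set ν : ℝ := (n : ℝ)
  have hkt : 0 ≤ k * (1 - t) := mul_nonneg (by linarith) (by linarith)
  set G := ν / 4 + k * (1 - t) with hG
  have hG0 : 0 ≤ G := by positivity
  have hG1 : G ≤ ν * k := by
    have : k * (1 - t) ≤ k := mul_le_of_le_one_right (by linarith) (by linarith)
    nlinarith
  have hνk : 2 ≤ ν * k := by nlinarith
  have hνk1 : ν ≤ ν * k := by nlinarith
  have hνk2 : 2 * k ≤ ν * k := by nlinarith
  have hsq : G ^ 2 ≤ (ν * k) ^ 2 := by gcongr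
  have hY : 2 * (ν * k) ≤ (ν * k) ^ 2 := by nlinarith
  have e1 : 0 ≤ t * (G ^ 2 + k) := by positivity
  have e2 : t * (G ^ 2 + k) ≤ G ^ 2 + k := mul_le_of_le_one_left (by positivity) h1
  have e3 : 0 ≤ k * t := by positivity
  have e4 : k * t ≤ k := mul_le_of_le_one_right (by linarith) h1
  have e5 : 0 ≤ ν * G := by positivity
  have e6 : ν * G ≤ (ν * k) ^ 2 := by
    calc ν * G ≤ (ν * k) * (ν * k) := by gcongr
      _ = _ := by ring
  rw [abs_le]
  constructor <;> nlinarith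

lemma le_abs_potentialProfile (hn : 2 ≤ n) {k t : ℝ} (hk : 200 * n ≤ k) (h0 : 1 / 4 ≤ t)
    (h1 : t ≤ 1 / 2) : 1 / 8 * k ^ 2 ≤ |potentialProfile n k t| := by
  have hν : (2 : ℝ) ≤ n := by exact_mod_cast hn
  refine le_trans ?_ (le_abs_self _)
  rw [potentialProfile]
  set ν : ℝ := (n : ℝ)
  set G := ν / 4 + k * (1 - t) with hG
  have hG0 : k / 2 ≤ G := by nlinarith
  have hG1 : G ≤ ν / 4 + k := by nlinarith
  have hsq : (k / 2) ^ 2 ≤ G ^ 2 := by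
    have : 0 ≤ k / 2 := by linarith
    gcongr
  have e1 : G ^ 2 + k ≤ 4 * t * (G ^ 2 + k) :=
    le_mul_of_one_le_left (by nlinarith [sq_nonneg G]) (by linarith)
  have e2 : ν * G ≤ ν * (ν / 4 + k) := by gcongr
  have e3 : 0 ≤ k * t := mul_nonneg (by linarith) (by linarith)
  have e4 : 200 * (ν * k) ≤ k * k := by nlinarith
  have e5 : 200 * (ν * ν) ≤ ν * k := by nlinarith
  nlinarith

lemma abs_driftProfile_le (hn : 2 ≤ n) {k t : ℝ} (hk : 1 ≤ k) (h0 : 0 ≤ t) (h1 : t ≤ 1) :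
    |driftProfile n k t| ≤ 20 * n ^ 2 * k := by
  have hν : (2 : ℝ) ≤ n := by exact_mod_cast hn
  have hP := one_le_bumpSlope (by linarith : 0 ≤ k) h0 h1
  rw [driftProfile]
  set ν : ℝ := (n : ℝ)
  have e3 : 0 ≤ k * t := by positivity
  have e4 : k * t ≤ k := mul_le_of_le_one_right (by linarith) h1
  have e5 : ν * (k * t) ≤ ν * k := by gcongr
  have e6 : 0 ≤ ν * (k * t) := by positivity
  have e7 : ν ≤ ν * k := by nlinarith
  have hX : |2 * (k - 1 - 2 * k * t) + ν * (k + 1) - ν * k * t| ≤ 4 * k + 2 * (ν * k) := by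
    rw [abs_le]
    constructor <;> nlinarith
  have hX' : |(2 * (k - 1 - 2 * k * t) + ν * (k + 1) - ν * k * t) / bumpSlope 1 k t| ≤
      4 * k + 2 * (ν * k) := by
    rw [abs_div]
    refine (div_le_self (abs_nonneg _) ?_).trans hX
    exact hP.trans (le_abs_self _)
  refine (abs_add_le _ _).trans ?_
  have h2 : |-2 * (1 + k * t)| ≤ 4 * k := by
    rw [abs_le]
    constructor <;> nlinarith
  have h3 : 2 * k ≤ ν * k := by nlinarith
  have h4 : 2 * (ν * k) ≤ ν * (ν * k) := by gcongr
  nlinarith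

lemma le_abs_driftProfile (hn : 2 ≤ n) {k t : ℝ} (hk : 200 * n ≤ k) (h0 : 1 / 4 ≤ t)
    (h1 : t ≤ 1 / 2) : 1 / 4 * k ≤ |driftProfile n k t| := by
  have hν : (2 : ℝ) ≤ n := by exact_mod_cast hn
  refine le_trans ?_ (neg_le_abs _)
  rw [driftProfile]
  set ν : ℝ := (n : ℝ)
  have hk0 : 0 < k := by linarith
  have e1 : k / 4 ≤ k * t := by nlinarith
  -- The quotient in `driftProfile` is bounded for `1 / 4 ≤ t ≤ 1 / 2`, since its denominator is of
  -- order `k` there; the term `-2 (1 + k t)` dominates.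
  have hP : k / 8 ≤ bumpSlope 1 k t := by
    rw [bumpSlope]
    have : 1 / 2 * (k / 4) ≤ (1 - t) * (1 + k * t) := by
      apply mul_le_mul <;> linarith
    linarith
  have hX : (2 * (k - 1 - 2 * k * t) + ν * (k + 1) - ν * k * t) / bumpSlope 1 k t ≤ 24 * ν := by
    rw [div_le_iff₀ (by linarith)]
    have h2 : ν * (k / 4) ≤ ν * (k * t) := by gcongr
    have h3 : 24 * ν * (k / 8) ≤ 24 * ν * bumpSlope 1 k t := by gcongr
    nlinarith
  linarith

lemma norm_potential_le (hn : 2 ≤ n) {R k : ℝ} (hR : 0 < R) (hk : 1 ≤ k)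
    {x : EuclideanSpace ℝ (Fin n)} (hx : x ∈ ball (0 : EuclideanSpace ℝ (Fin n)) R) :
    ‖potential R k x‖ ≤ 20 * n ^ 2 * (k / R) ^ (2 : ℝ) := by
  have ht := sq_div_sq_mem_Ico (norm_nonneg x) (mem_ball_zero_iff.1 hx)
  rw [potential, norm_mul, Real.norm_of_nonneg (by positivity), Real.norm_eq_abs, Real.rpow_two]
  calc _ ≤ (R ^ 2)⁻¹ * (20 * n ^ 2 * k ^ 2) := by
        gcongr
        exact abs_potentialProfile_le hn hk ht.1 ht.2.le
    _ = _ := by field_simp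

lemma norm_drift_le (hn : 2 ≤ n) {R k : ℝ} (hR : 0 < R) (hk : 1 ≤ k)
    {x : EuclideanSpace ℝ (Fin n)} (hx : x ∈ ball (0 : EuclideanSpace ℝ (Fin n)) R) :
    ‖drift R k x‖ ≤ 20 * n ^ 2 * (k / R) ^ (1 : ℝ) := by
  have hx' := mem_ball_zero_iff.1 hx
  have ht := sq_div_sq_mem_Ico (norm_nonneg x) hx'
  rw [drift, norm_smul, norm_mul, Real.norm_of_nonneg (by positivity), Real.norm_eq_abs,
    Real.rpow_one]
  calc _ ≤ (R ^ 2)⁻¹ * (20 * n ^ 2 * k) * R := by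
        gcongr
        exact abs_driftProfile_le hn hk ht.1 ht.2.le
    _ = _ := by field_simp

/-- A ball on which `1 / 4 ≤ |x|² / R² ≤ 1 / 2`. -/
lemma exists_ball_subset_annulus [NeZero n] {R : ℝ} (hR : 0 < R) :
    ∃ y : EuclideanSpace ℝ (Fin n), ball y (R / 10) ⊆ ball 0 R ∧
      ∀ x ∈ ball y (R / 10), R / 2 ≤ ‖x‖ ∧ 1 / 4 ≤ ‖x‖ ^ 2 / R ^ 2 ∧ ‖x‖ ^ 2 / R ^ 2 ≤ 1 / 2 := by
  have hy : ‖EuclideanSpace.single (0 : Fin n) (3 * R / 5)‖ = 3 * R / 5 := by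
    rw [PiLp.norm_single, Real.norm_of_nonneg (by positivity)]
  have key : ∀ x ∈ ball (EuclideanSpace.single (0 : Fin n) (3 * R / 5)) (R / 10),
      R / 2 ≤ ‖x‖ ∧ ‖x‖ ≤ 7 * R / 10 := by
    intro x hx
    rw [mem_ball, dist_eq_norm] at hx
    have h1 := norm_sub_norm_le x (EuclideanSpace.single (0 : Fin n) (3 * R / 5))
    have h2 := norm_sub_norm_le (EuclideanSpace.single (0 : Fin n) (3 * R / 5)) x
    rw [norm_sub_rev] at h2
    constructor <;> linarith
  refine ⟨_, fun x hx => ?_, fun x hx => ⟨(key x hx).1, ?_, ?_⟩⟩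
  · rw [mem_ball_zero_iff]; linarith [(key x hx).2]
  · rw [le_div_iff₀ (by positivity)]; nlinarith [(key x hx).1]
  · rw [div_le_iff₀ (by positivity)]; nlinarith [(key x hx).2, norm_nonneg x]

lemma le_norm_potential (hn : 2 ≤ n) {R k : ℝ} (hR : 0 < R) (hk : 200 * n ≤ k)
    {x : EuclideanSpace ℝ (Fin n)} (h0 : 1 / 4 ≤ ‖x‖ ^ 2 / R ^ 2) (h1 : ‖x‖ ^ 2 / R ^ 2 ≤ 1 / 2) :
    1 / 8 * (k / R) ^ (2 : ℝ) ≤ ‖potential R k x‖ := by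
  rw [potential, norm_mul, Real.norm_of_nonneg (by positivity), Real.norm_eq_abs, Real.rpow_two]
  calc _ = (R ^ 2)⁻¹ * (1 / 8 * k ^ 2) := by field_simp
    _ ≤ _ := by
        gcongr
        exact le_abs_potentialProfile hn hk h0 h1

lemma le_norm_drift (hn : 2 ≤ n) {R k : ℝ} (hR : 0 < R) (hk : 200 * n ≤ k)
    {x : EuclideanSpace ℝ (Fin n)} (hx : R / 2 ≤ ‖x‖) (h0 : 1 / 4 ≤ ‖x‖ ^ 2 / R ^ 2)
    (h1 : ‖x‖ ^ 2 / R ^ 2 ≤ 1 / 2) :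
    1 / 8 * (k / R) ^ (1 : ℝ) ≤ ‖drift R k x‖ := by
  rw [drift, norm_smul, norm_mul, Real.norm_of_nonneg (by positivity), Real.norm_eq_abs,
    Real.rpow_one]
  calc _ = (R ^ 2)⁻¹ * (1 / 4 * k) * (R / 2) := by field_simp; ring
    _ ≤ _ := by
        gcongr
        exact le_abs_driftProfile hn hk h0 h1

end

/-! ### Sharpness of the estimates -/

theorem mainTheorem12 (n : ℕ) (hn : 2 ≤ n) :
    ∃ lam₀ : ℝ, 0 < lam₀ ∧ ∃ C : ℝ, 0 < C ∧
      ∀ (q : ℝ≥0∞) (_ : (n : ℝ≥0∞) < q)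
        (α : ℝ) (_ : 0 < α) (_ : α < 1 - ((n : ℝ≥0∞) / q).toReal)
        (cΩ : ℝ) (_ : 0 < cΩ) (R : ℝ) (_ : 0 < R),
        (∃ (c : ℕ → EuclideanSpace ℝ (Fin n) → ℝ) (u : ℕ → EuclideanSpace ℝ (Fin n) → ℝ)
            (r N M : ℕ → ℝ),
          (∀ i, r i = (schrodingerOp (c i)).r₀ q α (cΩ * R) (ball 0 R)) ∧
          (∀ i, N i = (ulNorm q (r i) (ball 0 R) (c i)).toReal) ∧
          (∀ i, M i = N i ^ gammaExp n q) ∧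
          (∀ i, ContDiffOn ℝ ∞ (c i) (closedBall 0 R)) ∧
          (∀ i, IsPositiveDirichletSolution R (fun _ => 0) (c i) (u i)) ∧
          Tendsto N atTop atTop ∧ Tendsto M atTop atTop ∧
          ∀ i, HarnackLowerBounds R C (M i) (u i)) ∧
        (∃ (b : ℕ → EuclideanSpace ℝ (Fin n) → EuclideanSpace ℝ (Fin n))
            (u : ℕ → EuclideanSpace ℝ (Fin n) → ℝ) (r N M : ℕ → ℝ),
          (∀ i, r i = (driftOp (b i) (lam₀ * (R ^ 2)⁻¹)).r₀ q α (cΩ * R) (ball 0 R)) ∧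
          (∀ i, N i = (ulNorm q (r i) (ball 0 R) (b i)).toReal) ∧
          (∀ i, M i = N i ^ betaExp n q) ∧
          (∀ i, ContDiffOn ℝ ∞ (b i) (closedBall 0 R)) ∧
          (∀ i, IsPositiveDirichletSolution R (b i) (fun _ => -(lam₀ * (R ^ 2)⁻¹)) (u i)) ∧
          Tendsto N atTop atTop ∧ Tendsto M atTop atTop ∧
          ∀ i, HarnackLowerBounds R C (M i) (u i)) := by
  have : NeZero n := ⟨by omega⟩
  have hn1 : (2 : ℝ) ≤ n := by exact_mod_cast hn
  have hK1 : (1 : ℝ) ≤ 20 * (n : ℝ) ^ 2 := by nlinarith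
  have hW : 1 ≤ max 1 (unitBallVol n) := le_max_left _ _
  have hK : 1 ≤ 20 * (n : ℝ) ^ 2 * max 1 (unitBallVol n) := one_le_mul_of_one_le_of_one_le hK1 hW
  refine ⟨4 * n, by positivity, 1 / (32 * (20 * (n : ℝ) ^ 2 * max 1 (unitBallVol n))),
    by positivity, fun q hq α hα0 hα1 cΩ hcΩ R hR => ?_⟩
  have hp : ((n : ℝ≥0∞) / q).toReal < 1 := by linarith
  have hrΩ : 0 < cΩ * R := by positivity
  have hk0 : ∀ i : ℕ, (0 : ℝ) ≤ i + 1 := fun i => by positivity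
  have hk1 : ∀ i : ℕ, (1 : ℝ) ≤ i + 1 := fun i => by linarith [i.cast_nonneg (α := ℝ)]
  have hκpos : ∀ i : ℕ, 0 < ((i : ℝ) + 1) / R := fun i => by positivity
  have hktop : Tendsto (fun i : ℕ => (i : ℝ) + 1) atTop atTop :=
    tendsto_atTop_add_const_right _ _ tendsto_natCast_atTop_atTop
  have hκ : Tendsto (fun i : ℕ => ((i : ℝ) + 1) / R) atTop atTop := hktop.atTop_div_const hR
  obtain ⟨y, hy, hyann⟩ := exists_ball_subset_annulus (n := n) hR
  -- In both parts the parameter is `k = i + 1`; bounds that need a large `k` enter only the limits.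
  constructor
  · have hcont := fun i : ℕ => contDiff_potential (n := n) R (i + 1)
    have hN : Tendsto (fun i : ℕ => (ulNorm q
        ((schrodingerOp (potential (n := n) R (i + 1))).r₀ q α (cΩ * R) (ball 0 R)) (ball 0 R)
        (potential (n := n) R (i + 1))).toReal) atTop atTop := by
      refine DivFormOperator.tendsto_ulNorm_r₀ hn hq hrΩ one_le_two le_rfl hp measurableSet_ball
        (Z := 0) le_rfl (fun i r => ?_) hK1 (by norm_num : (0 : ℝ) < 1 / 8)
        (by positivity : 0 < R / 10) hκ (fun i x hx => norm_potential_le hn hR (hk1 i) hx) hy ?_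
      · rw [coeffSize_schrodingerOp hp hα0]
        exact le_self_add
      · filter_upwards [hktop.eventually_ge_atTop (200 * (n : ℝ))] with i hi x hx
        exact le_norm_potential hn hR hi (hyann x hx).2.1 (hyann x hx).2.2
    refine ⟨fun i => potential R (i + 1), fun i => dampedBump R (n / 4 + (i + 1)) (-(i + 1)),
      _, _, _, fun i => rfl, fun i => rfl, fun i => rfl, fun i => (hcont i).contDiffOn,
      fun i => isPositiveDirichletSolution_dampedBump hR _ _ fun x _ => potential_equation R _ x,
      hN, (tendsto_rpow_atTop (gammaExp_pos hp)).comp hN, fun i => ?_⟩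
    have hi := hk1 i
    refine harnackLowerBounds_dampedBump hR (by positivity) (by ring_nf; positivity) (hk0 i) ?_ ?_
      hK ?_
    · rw [quadExponent]; linarith
    · linarith
    · exact DivFormOperator.ulNorm_r₀_rpow_le hn hq one_le_two hp measurableSet_ball
        (hcont i).continuous.aestronglyMeasurable
        (fun r => (coeffSize_schrodingerOp hp hα0 r _ _).ge) hK1 (hκpos i)
        fun x hx => norm_potential_le hn hR (hk1 i) hx
  · have hcont := fun i : ℕ => contDiffOn_drift (n := n) hR (hk0 i)
    set μ : ℝ := 4 * n * (R ^ 2)⁻¹ with hμ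
    have hZ : eLpNorm (fun _ : EuclideanSpace ℝ (Fin n) => μ) q (volume.restrict (ball 0 R)) ^
        gammaExp n q ≠ ⊤ := by
      have : IsFiniteMeasure (volume.restrict (ball (0 : EuclideanSpace ℝ (Fin n)) R)) :=
        ⟨by rw [Measure.restrict_apply_univ]; exact measure_ball_lt_top⟩
      exact ENNReal.rpow_ne_top_of_nonneg (gammaExp_pos hp).le (memLp_const μ).2.ne
    have hN : Tendsto (fun i : ℕ => (ulNorm q
        ((driftOp (drift (n := n) R (i + 1)) μ).r₀ q α (cΩ * R) (ball 0 R)) (ball 0 R)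
        (drift (n := n) R (i + 1))).toReal) atTop atTop := by
      refine DivFormOperator.tendsto_ulNorm_r₀ hn hq hrΩ le_rfl one_le_two hp measurableSet_ball
        (Z := (eLpNorm (fun _ : EuclideanSpace ℝ (Fin n) => μ) q (volume.restrict (ball 0 R)) ^
          gammaExp n q).toReal) ENNReal.toReal_nonneg (fun i r => ?_) hK1
        (by norm_num : (0 : ℝ) < 1 / 8) (by positivity : 0 < R / 10) hκ
        (fun i x hx => norm_drift_le hn hR (hk1 i) hx) hy ?_
      · rw [coeffSize_driftOp hα0, ENNReal.ofReal_toReal hZ]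
        refine add_le_add le_rfl (ENNReal.rpow_le_rpow ?_ (gammaExp_pos hp).le)
        exact ulNorm_le_eLpNorm _ _ _ _
      · filter_upwards [hktop.eventually_ge_atTop (200 * (n : ℝ))] with i hi x hx
        exact le_norm_drift hn hR hi (hyann x hx).1 (hyann x hx).2.1 (hyann x hx).2.2
    refine ⟨fun i => drift R (i + 1), fun i => dampedBump R 1 (i + 1),
      _, _, _, fun i => rfl, fun i => rfl, fun i => rfl, hcont,
      fun i => isPositiveDirichletSolution_dampedBump hR _ _ fun x hx => drift_equation (hk0 i) hx,
      hN, (tendsto_rpow_atTop (betaExp_pos hp)).comp hN, fun i => ?_⟩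
    have hi := hk1 i
    refine harnackLowerBounds_dampedBump hR zero_le_one (by linarith) (hk0 i) ?_ ?_ hK ?_
    · rw [quadExponent]; linarith
    · linarith
    · exact DivFormOperator.ulNorm_r₀_rpow_le hn hq le_rfl hp measurableSet_ball
        (((hcont i).continuousOn.mono ball_subset_closedBall).aestronglyMeasurable
          measurableSet_ball)
        (fun r => le_self_add.trans (coeffSize_driftOp hα0 r _ _ _).ge) hK1 (hκpos i)
        fun x hx => norm_drift_le hn hR (hk1 i) hx
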